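/- Let $E$ be a finite or countable set, let $\ell^2(E)$ be the real or complex Hilbert space with standard orthonormal basis $(\delta_e)_{e\in E}$, and let $H\subseteq \ell^2(E)$ be a closed subspace with orthogonal projection $P_H$. Let $\mathbf P^H$ be the determinantal probability measure of $H$, that is, the unique probability measure on $2^E$ (the set of subsets of $E$ with its product $\sigma$-field) such that for every finite $A\subseteq E$, $$\mathbf P^H\{B\subseteq E : A\subseteq B\}=\det\bigl[\langle P_H\delta_e,\delta_f\rangle\bigr]_{e,f\in A}.$$ For $K\subseteq E$ let $\mathcal F(K)$ be the $\sigma$-field on $2^E$ generated by the events $\{B : e\in B\}$, $e\in K$. Then $\mathbf P^H$ has trivial tail: every event in the tail $\sigma$-field $\bigcap_{K\subseteq E\text{ finite}}\mathcal F(E\setminus K)$ has $\mathbf P^H$-measure $0$ or $1$. Moreover, for every $\mathcal A_1\in\mathcal F(E)$ and every $\epsilon>0$ there is a finite set $K\subseteq E$ such that for all $\mathcal A_2\in\mathcal F(E\setminus K)$, $$\bigl|\mathbf P^H(\mathcal A_1\cap\mathcal A_2)-\mathbf P^H(\mathcal A_1)\,\mathbf P^H(\mathcal A_2)\bigr|<\epsilon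 .$$ -/

import Mathlib

namespace DeterminantalProbability

open MeasureTheory Filter Topology
open scoped ENNReal lp ComplexOrder Matrix InnerProductSpace

open Classical in
/-- The matrix of the orthogonal projection `P_H` of `ℓ²(E)` onto the closed subspace `H`, with
respect to the standard orthonormal basis `(δ_e)`: its `(e, f)` entry is `⟨δ_e, P_H δ_f⟩`
(Mathlib's inner product is conjugate-linear in the first variable). -/
noncomputable def projMatrix {𝕜 : Type*} [RCLike 𝕜] {E : Type*} (H : ClosedSubmodule 𝕜 ℓ²(E, 𝕜)) :
    Matrix E E 𝕜 :=
  Matrix.of fun e f => inner 𝕜 (lp.single 2 e (1 : 𝕜) : ℓ²(E, 𝕜))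
    (H.toSubmodule.starProjection (lp.single 2 f (1 : 𝕜)))

open Classical in
/-- `μ` is the determinantal probability measure on the subsets of `E` with matrix `Q`: a random
set `B` with law `μ` satisfies `P[A ⊆ B] = det (Q restricted to A)` for all finite `A ⊆ E`. -/
structure IsDeterminantal {𝕜 : Type*} [RCLike 𝕜] {E : Type*} (Q : Matrix E E 𝕜)
    (μ : Measure (Set E)) : Prop where
  isProbabilityMeasure : IsProbabilityMeasure μ
  prob_subset : ∀ A : Finset E, ((μ.real {B : Set E | (A : Set E) ⊆ B} : ℝ) : 𝕜) =
    (Q.submatrix (fun a : A => (a : E)) (fun a : A => (a : E))).det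

/-- The `σ`-field `𝓕(K)` of events that are measurable with respect to `K`, generated by the events
`{e ∈ B}` with `e ∈ K`. -/
@[reducible] def sigmaField {E : Type*} (K : Set E) : MeasurableSpace (Set E) :=
  MeasurableSpace.generateFrom {S | ∃ e ∈ K, S = {B : Set E | e ∈ B}}

/-- The tail `σ`-field, the intersection of `𝓕(E ∖ K)` over all finite `K ⊆ E`. -/
@[reducible] def tailSigmaField (E : Type*) : MeasurableSpace (Set E) :=
  ⨅ K : Finset E, sigmaField (K : Set E)ᶜ

/-- Every event in the tail `σ`-field has measure `0` or `1`. -/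
def HasTrivialTail {E : Type*} (μ : Measure (Set E)) : Prop :=
  ∀ S : Set (Set E), MeasurableSet[tailSigmaField E] S → μ S = 0 ∨ μ S = 1

/-! Existence and uniqueness of the determinantal measure of a closed subspace, needed to define
it. The auxiliary matrix `cylMat s Q` has determinant `P[B = s]` when the ground set is finite. -/

def cylMat {𝕜 : Type*} [RCLike 𝕜] {n : Type*} [DecidableEq n] (s : Finset n)
    (Q : Matrix n n 𝕜) : Matrix n n 𝕜 :=
  Matrix.of fun i j => if i ∈ s then Q i j else (1 - Q) i j

theorem cylMat_eq {𝕜 : Type*} [RCLike 𝕜] {n : Type*} [Fintype n] [DecidableEq n] (s : Finset n)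
    (Q : Matrix n n 𝕜) :
    cylMat s Q = Matrix.diagonal (fun i => if i ∈ s then (1 : 𝕜) else -1) *
      (Q - Matrix.diagonal (fun i => if i ∈ s then (0 : 𝕜) else 1)) := by
  ext i j
  by_cases hi : i ∈ s <;> by_cases hij : i = j <;>
    simp [cylMat, Matrix.diagonal_mul, Matrix.one_apply, hi, hij]
  · subst hij; simp [hi]
  · subst hij; simp [hi]

theorem conj_det_cylMat {𝕜 : Type*} [RCLike 𝕜] {n : Type*} [Fintype n] [DecidableEq n]
    (s : Finset n) (Q : Matrix n n 𝕜) (hQ : Q.IsHermitian) :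
    star (cylMat s Q).det = (cylMat s Q).det := by
  rw [cylMat_eq, Matrix.det_mul, star_mul', ← Matrix.det_conjTranspose, ← Matrix.det_conjTranspose,
    Matrix.conjTranspose_sub, hQ.eq, Matrix.diagonal_conjTranspose, Matrix.diagonal_conjTranspose]
  congr 4
  · ext i; by_cases hi : i ∈ s <;> simp [hi]
  · ext i; by_cases hi : i ∈ s <;> simp [hi]

theorem det_cylMat_ne_zero {𝕜 : Type*} [RCLike 𝕜] {n : Type*} [Fintype n] [DecidableEq n]
    (s : Finset n) (Q : Matrix n n 𝕜) (hQ : Q.IsHermitian) (hpd : (Q - Q * Q).PosDef) :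
    (cylMat s Q).det ≠ 0 := by
  intro h0
  obtain ⟨x, hx, hx0⟩ := Matrix.exists_mulVec_eq_zero_iff.2 h0
  have hpos := hpd.dotProduct_mulVec_pos hx
  have h1 : ∀ i, if i ∈ s then (Q *ᵥ x) i = 0 else x i - (Q *ᵥ x) i = 0 := by
    intro i
    have := congrFun hx0 i
    by_cases hi : i ∈ s
    · simpa [cylMat, Matrix.mulVec, dotProduct, hi] using this
    · have h2 : ((1 - Q) *ᵥ x) i = 0 := by
        simpa [cylMat, Matrix.mulVec, dotProduct, hi] using this
      simpa [hi, Matrix.sub_mulVec] using h2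
  have h2 : star x ⬝ᵥ ((Q - Q * Q) *ᵥ x) = star (Q *ᵥ x) ⬝ᵥ (x - Q *ᵥ x) := by
    rw [Matrix.star_mulVec, hQ.eq, ← Matrix.dotProduct_mulVec, Matrix.mulVec_sub,
      Matrix.sub_mulVec, Matrix.mulVec_mulVec]
  rw [h2] at hpos
  have h3 : star (Q *ᵥ x) ⬝ᵥ (x - Q *ᵥ x) = 0 := by
    refine Finset.sum_eq_zero fun i _ => ?_
    have := h1 i
    by_cases hi : i ∈ s
    · rw [if_pos hi] at this; simp [this]
    · rw [if_neg hi] at this; simp [this]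
  exact hpos.ne' h3

theorem det_cylMat_nonneg {𝕜 : Type*} [RCLike 𝕜] {n : Type*} [Fintype n] [DecidableEq n]
    (s : Finset n) (Q : Matrix n n 𝕜) (hQ : Q.IsHermitian) (hps : (Q - Q * Q).PosSemidef) :
    0 ≤ (cylMat s Q).det := by
  let R : ℝ → Matrix n n 𝕜 := fun t => ((1 - t : ℝ) : 𝕜) • Q + ((t / 2 : ℝ) : 𝕜) • 1
  have hR : ∀ t, (R t).IsHermitian := by
    intro t
    simp [R, Matrix.IsHermitian, Matrix.conjTranspose_add, Matrix.conjTranspose_smul, hQ.eq]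
  have hRpd : ∀ t ∈ Set.Ioc (0 : ℝ) 1, (R t - R t * R t).PosDef := by
    intro t ht
    have : R t - R t * R t = (((1 - t) ^ 2 : ℝ) : 𝕜) • (Q - Q * Q)
        + ((t / 2 - t ^ 2 / 4 : ℝ) : 𝕜) • 1 := by
      simp only [R, mul_add, add_mul, smul_mul_assoc, mul_smul_comm, mul_one, one_mul, smul_sub]
      push_cast
      module
    rw [this]
    refine Matrix.PosDef.posSemidef_add (hps.smul ?_) (Matrix.PosDef.one.smul ?_)
    · exact RCLike.ofReal_nonneg.2 (sq_nonneg _)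
    · exact RCLike.ofReal_pos.2 (by nlinarith [ht.1, ht.2])
  let f : ℝ → ℝ := fun t => RCLike.re (cylMat s (R t)).det
  have hf : ∀ t, ((f t : ℝ) : 𝕜) = (cylMat s (R t)).det := fun t =>
    RCLike.conj_eq_iff_re.1 (conj_det_cylMat s _ (hR t))
  have hcont : Continuous f := by
    refine RCLike.continuous_re.comp (Continuous.matrix_det ?_)
    refine continuous_matrix fun i j => ?_
    have : Continuous fun t => R t := by
      simp only [R]
      fun_prop
    by_cases hi : i ∈ s
    · simpa [cylMat, hi] using this.matrix_elem i j
    · simp only [cylMat, hi, Matrix.of_apply, if_false, Matrix.sub_apply]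
      exact continuous_const.sub (this.matrix_elem i j)
  have hne : ∀ t ∈ Set.Ioc (0 : ℝ) 1, f t ≠ 0 := by
    intro t ht h0
    apply det_cylMat_ne_zero s (R t) (hR t) (hRpd t ht)
    rw [← hf, h0, RCLike.ofReal_zero]
  have h1 : 0 < f 1 := by
    have h2 : cylMat s (R 1) = Matrix.diagonal fun _ => ((1 / 2 : ℝ) : 𝕜) := by
      ext i j
      by_cases hij : i = j
      · subst hij
        by_cases hi : i ∈ s
        · simp [cylMat, R, hi]
        · simp only [cylMat, R, hi, Matrix.of_apply, if_false, Matrix.sub_apply, sub_self,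
            Matrix.add_apply, Matrix.smul_apply, RCLike.ofReal_zero, zero_smul, zero_add,
            Matrix.one_apply_eq, smul_eq_mul, mul_one, Matrix.diagonal_apply_eq]
          rw [← RCLike.ofReal_one, ← RCLike.ofReal_sub]
          norm_num
      · by_cases hi : i ∈ s <;> simp [cylMat, R, hi, hij]
    have h3 : ((f 1 : ℝ) : 𝕜) = (((1 / 2) ^ Fintype.card n : ℝ) : 𝕜) := by
      rw [hf, h2, Matrix.det_diagonal]
      simp
    rw [RCLike.ofReal_inj.1 h3]
    positivity
  have hpos : ∀ t ∈ Set.Ioc (0 : ℝ) 1, 0 ≤ f t := by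
    intro t ht
    by_contra! hneg
    obtain ⟨u, hu, hu0⟩ := intermediate_value_Icc ht.2 hcont.continuousOn ⟨hneg.le, h1.le⟩
    exact hne u ⟨ht.1.trans_le hu.1, hu.2⟩ hu0
  have h0 : 0 ≤ f 0 := by
    have hlim : Tendsto f (𝓝[>] 0) (𝓝 (f 0)) := hcont.continuousAt.mono_left nhdsWithin_le_nhds
    refine ge_of_tendsto hlim ?_
    filter_upwards [Ioc_mem_nhdsGT (zero_lt_one (α := ℝ))] with t ht using hpos t ht
  have hR0 : R 0 = Q := by simp [R]
  rw [← hR0, ← hf]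
  exact RCLike.ofReal_nonneg.2 h0

theorem sum_det_cylMat {𝕜 : Type*} [RCLike 𝕜] {n : Type*} [Fintype n] [DecidableEq n]
    (A : Finset n) (Q : Matrix n n 𝕜) :
    ∑ s : Finset n, (if A ⊆ s then (cylMat s Q).det else 0)
      = (Q.submatrix (fun i : A => (i : n)) (fun i : A => (i : n))).det := by
  let q : n → n → 𝕜 := fun i => Q i
  let m' : n → n → 𝕜 := fun i => if i ∈ A then 0 else (1 - Q) i
  have h1 : Matrix.det (Matrix.of (q + m'))
      = ∑ s : Finset n, Matrix.det (Matrix.of (s.piecewise q m')) :=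
    (Matrix.detRowAlternating (n := n) (R := 𝕜)).map_add_univ q m'
  have h2 : ∀ s : Finset n, Matrix.det (Matrix.of (s.piecewise q m'))
      = if A ⊆ s then (cylMat s Q).det else 0 := by
    intro s
    split_ifs with hs
    · congr 1
      ext i j
      by_cases hi : i ∈ s
      · simp [cylMat, q, hi]
      · have hA : i ∉ A := fun h => hi (hs h)
        simp [cylMat, hi, q, m', hA]
    · obtain ⟨i, hiA, his⟩ := Finset.not_subset.1 hs
      refine Matrix.det_eq_zero_of_row_eq_zero i fun j => ?_
      simp [his, m', hiA]
  rw [Finset.sum_congr rfl fun s _ => (h2 s).symm, ← h1]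
  have hN1 : ∀ i j, i ∈ A → (q + m') i j = Q i j := by
    intro i j hi
    simp [q, m', hi]
  have hN2 : ∀ i j, i ∉ A → (q + m') i j = (1 : Matrix n n 𝕜) i j := by
    intro i j hi
    simp [q, m', hi]
  generalize q + m' = N at hN1 hN2
  rw [Matrix.twoBlockTriangular_det (Matrix.of N) (fun i => i ∈ A)]
  · have h3 : Matrix.toSquareBlockProp (Matrix.of N) (fun i => ¬ i ∈ A) = 1 := by
      ext ⟨i, hi⟩ ⟨j, hj⟩
      simp [Matrix.toSquareBlockProp, hN2 i j hi, Matrix.one_apply]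
    have h4 : Matrix.toSquareBlockProp (Matrix.of N) (fun i => i ∈ A) =
        Q.submatrix (fun i : A => (i : n)) (fun i : A => (i : n)) := by
      ext ⟨i, hi⟩ ⟨j, hj⟩
      simp [Matrix.toSquareBlockProp, hN1 i j hi]
    rw [h3, Matrix.det_one, mul_one, h4]
    congr!
  · intro i hi j hj
    have : i ≠ j := fun h => hi (h ▸ hj)
    simp [hN2 i j hi, this]

theorem posSemidef_gram_sub_sq {𝕜 : Type*} [RCLike 𝕜] {V : Type*} [NormedAddCommGroup V]
    [InnerProductSpace 𝕜 V] (U : Submodule 𝕜 V) [U.HasOrthogonalProjection]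
    {n : Type*} [Fintype n] (v : n → V) (hv : Orthonormal 𝕜 v) (Q : Matrix n n 𝕜)
    (hQ : Q = Matrix.of fun i j => inner 𝕜 (v i) (U.starProjection (v j))) :
    Q.IsHermitian ∧ (Q - Q * Q).PosSemidef := by
  have hH : Q.IsHermitian := by
    ext i j
    simp [hQ, Matrix.conjTranspose_apply, Submodule.inner_starProjection_left_eq_right]
  refine ⟨hH, Matrix.PosSemidef.of_dotProduct_mulVec_nonneg
    (hH.sub (by rw [Matrix.IsHermitian, Matrix.conjTranspose_mul, hH.eq])) fun x => ?_⟩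
  set w : V := ∑ j, x j • v j with hw
  have h1 : ∀ i, (Q *ᵥ x) i = inner 𝕜 (v i) (U.starProjection w) := by
    intro i
    simp [hw, hQ, Matrix.mulVec, dotProduct, map_sum, inner_sum, inner_smul_right, mul_comm]
  have h2 : star x ⬝ᵥ (Q *ᵥ x) = ((‖U.starProjection w‖ ^ 2 : ℝ) : 𝕜) := by
    have h3 : inner 𝕜 w (U.starProjection w) = ((‖U.starProjection w‖ ^ 2 : ℝ) : 𝕜) := by
      have h4 : U.starProjection (U.starProjection w) = U.starProjection w :=
        Submodule.starProjection_eq_self_iff.2 (Submodule.starProjection_apply_mem _ _)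
      rw [← h4, ← Submodule.inner_starProjection_left_eq_right, h4, inner_self_eq_norm_sq_to_K]
      push_cast
      rfl
    rw [← h3]
    conv_rhs => rw [hw, sum_inner]
    simp only [dotProduct, h1, inner_smul_left]
    rfl
  have h5 : star x ⬝ᵥ ((Q * Q) *ᵥ x) = ((∑ i, ‖inner 𝕜 (v i) (U.starProjection w)‖ ^ 2 : ℝ) : 𝕜) := by
    rw [← Matrix.mulVec_mulVec, Matrix.dotProduct_mulVec]
    nth_rewrite 1 [← hH.eq]
    rw [← Matrix.star_mulVec]
    push_cast
    simp only [dotProduct, Pi.star_apply, h1]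
    refine Finset.sum_congr rfl fun i _ => ?_
    rw [← RCLike.conj_mul]
    rfl
  rw [Matrix.sub_mulVec, dotProduct_sub, h2, h5, ← RCLike.ofReal_sub]
  exact RCLike.ofReal_nonneg.2 (sub_nonneg.2 (hv.sum_inner_products_le _))

theorem measurableSet_superset {E : Type*} (A : Finset E) :
    MeasurableSet {B : Set E | (A : Set E) ⊆ B} := by
  have : {B : Set E | (A : Set E) ⊆ B} = ⋂ a ∈ A, {B : Set E | a ∈ B} := by
    ext B; simp [Set.subset_def]
  rw [this]
  exact Finset.measurableSet_biInter A fun a _ => measurableSet_mem a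

theorem IsDeterminantal.unique {𝕜 : Type*} [RCLike 𝕜] {E : Type*} {Q : Matrix E E 𝕜}
    {μ ν : Measure (Set E)} (hμ : IsDeterminantal Q μ) (hν : IsDeterminantal Q ν) : μ = ν := by
  classical
  have := hμ.isProbabilityMeasure
  have := hν.isProbabilityMeasure
  refine ext_of_generate_finite (Set.range fun A : Finset E => {B : Set E | (A : Set E) ⊆ B})
    (le_antisymm ?_ ?_) ?_ ?_ (by simp)
  · refine iSup_le fun e => ?_
    rintro _ ⟨S, -, rfl⟩
    have h : MeasurableSet[MeasurableSpace.generateFrom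
        (Set.range fun A : Finset E => {B : Set E | (A : Set E) ⊆ B})] {B : Set E | e ∈ B} :=
      MeasurableSpace.measurableSet_generateFrom ⟨{e}, by simp⟩
    have h' := @measurableSet_setOfPred _ (MeasurableSpace.generateFrom
        (Set.range fun A : Finset E => {B : Set E | (A : Set E) ⊆ B})) (fun B : Set E => e ∈ B)
    exact (h'.1 h) trivial
  · refine MeasurableSpace.generateFrom_le ?_
    rintro _ ⟨A, rfl⟩
    exact measurableSet_superset A
  · rintro _ ⟨A, rfl⟩ _ ⟨A', rfl⟩ -
    exact ⟨A ∪ A', by ext B; simp⟩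
  · rintro _ ⟨A, rfl⟩
    have h : μ.real {B : Set E | (A : Set E) ⊆ B} = ν.real {B : Set E | (A : Set E) ⊆ B} :=
      RCLike.ofReal_inj.1 ((hμ.prob_subset A).trans (hν.prob_subset A).symm)
    exact (measureReal_eq_measureReal_iff).1 h

open Classical in
theorem exists_finite_approx {𝕜 : Type*} [RCLike 𝕜] {E : Type*}
    (H : ClosedSubmodule 𝕜 ℓ²(E, 𝕜)) (F : Finset E) :
    ∃ μ : ProbabilityMeasure (E → Bool), ∀ A : Finset E, A ⊆ F →
      (((μ : Measure (E → Bool)).real {b | ∀ a ∈ A, b a = true} : ℝ) : 𝕜) =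
        ((projMatrix H).submatrix (fun a : A => (a : E)) (fun a : A => (a : E))).det := by
  classical
  let Q : Matrix F F 𝕜 := (projMatrix H).submatrix (fun a : F => (a : E)) (fun a : F => (a : E))
  have hv : Orthonormal 𝕜 (fun a : F => (lp.single 2 (a : E) (1 : 𝕜) : ℓ²(E, 𝕜))) := by
    rw [orthonormal_iff_ite]
    intro i j
    rw [lp.inner_single_left]
    by_cases hij : i = j
    · subst hij; simp
    · have : (i : E) ≠ j := fun h => hij (Subtype.ext h)
      simp [hij, lp.single_apply, this]
  obtain ⟨hQ, hps⟩ := posSemidef_gram_sub_sq H.toSubmodule _ hv Q (by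
    ext i j
    simp [Q, projMatrix])
  let p : Finset F → ℝ := fun s => RCLike.re (cylMat s Q).det
  have hp0 : ∀ s, 0 ≤ p s := fun s => (RCLike.nonneg_iff.1 (det_cylMat_nonneg s Q hQ hps)).1
  have hp : ∀ s, ((p s : ℝ) : 𝕜) = (cylMat s Q).det := fun s =>
    RCLike.conj_eq_iff_re.1 (conj_det_cylMat s _ hQ)
  let pt : Finset F → (E → Bool) := fun s e => decide (∃ h : e ∈ F, (⟨e, h⟩ : F) ∈ s)
  let m : Measure (E → Bool) := ∑ s : Finset F, ENNReal.ofReal (p s) • Measure.dirac (pt s)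
  have hm : ∀ A : Finset E, A ⊆ F → ((m.real {b | ∀ a ∈ A, b a = true} : ℝ) : 𝕜) =
        ((projMatrix H).submatrix (fun a : A => (a : E)) (fun a : A => (a : E))).det := by
    intro A hA
    have hmeas : MeasurableSet {b : E → Bool | ∀ a ∈ A, b a = true} := by
      have : {b : E → Bool | ∀ a ∈ A, b a = true} = ⋂ a ∈ A, (fun b => b a) ⁻¹' {true} := by
        ext b; simp
      rw [this]
      exact Finset.measurableSet_biInter A fun a _ => measurable_pi_apply a (measurableSet_singleton _)
    let A' : Finset F := A.subtype (· ∈ F)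
    have h1 : m {b | ∀ a ∈ A, b a = true}
        = ENNReal.ofReal (∑ s : Finset F, if A' ⊆ s then p s else 0) := by
      rw [ENNReal.ofReal_sum_of_nonneg fun s _ => by split_ifs <;> simp [hp0]]
      simp only [m, Measure.coe_finsetSum, Finset.sum_apply, Measure.smul_apply,
        Measure.dirac_apply' _ hmeas, smul_eq_mul]
      refine Finset.sum_congr rfl fun s _ => ?_
      have h2 : pt s ∈ {b : E → Bool | ∀ a ∈ A, b a = true} ↔ A' ⊆ s := by
        simp only [pt, Set.mem_ofPred_eq, decide_eq_true_eq, A', Finset.subset_iff,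
          Finset.mem_subtype]
        exact ⟨fun h a ha => (h a ha).2, fun h a ha => ⟨hA ha, h (x := ⟨a, hA ha⟩) ha⟩⟩
      by_cases hs : A' ⊆ s
      · rw [Set.indicator_of_mem (h2.2 hs)]; simp [hs]
      · rw [Set.indicator_of_notMem (fun h => hs (h2.1 h))]; simp [hs]
    have h3 : m.real {b | ∀ a ∈ A, b a = true} = ∑ s : Finset F, if A' ⊆ s then p s else 0 := by
      rw [Measure.real, h1, ENNReal.toReal_ofReal]
      exact Finset.sum_nonneg fun s _ => by split_ifs <;> simp [hp0]
    have h4 := sum_det_cylMat A' Q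
    rw [h3]
    push_cast
    simp only [apply_ite (RCLike.ofReal : ℝ → 𝕜), hp, RCLike.ofReal_zero]
    rw [h4]
    let e : A' ≃ A :=
      { toFun := fun a => ⟨a.1.1, Finset.mem_subtype.1 a.2⟩
        invFun := fun a => ⟨⟨a.1, hA a.2⟩, Finset.mem_subtype.2 a.2⟩
        left_inv := fun a => rfl
        right_inv := fun a => rfl }
    rw [← Matrix.det_submatrix_equiv_self e]
    congr 1
  have hprob : IsProbabilityMeasure m := by
    constructor
    have h := hm ∅ (by simp)
    have h1 : m.real Set.univ = 1 := by
      have : ((m.real Set.univ : ℝ) : 𝕜) = ((1 : ℝ) : 𝕜) := by simpa using h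
      exact RCLike.ofReal_inj.1 this
    have := (ENNReal.toReal_eq_one_iff _).1 h1
    exact this
  exact ⟨⟨m, hprob⟩, hm⟩

theorem exists_isDeterminantal {𝕜 : Type*} [RCLike 𝕜] {E : Type*} [Countable E]
    (H : ClosedSubmodule 𝕜 ℓ²(E, 𝕜)) : ∃ μ : Measure (Set E), IsDeterminantal (projMatrix H) μ := by
  classical
  choose μ hμ using exists_finite_approx H
  let 𝓤 : Ultrafilter (Finset E) := Ultrafilter.of atTop
  obtain ⟨ν, -, hν⟩ := isCompact_univ.ultrafilter_le_nhds (𝓤.map μ) (by simp)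
  have hlim : Tendsto μ 𝓤 (𝓝 ν) := hν
  let g : (E → Bool) → Set E := fun b => {e | b e = true}
  have hg : Measurable g := by
    refine measurable_set_iff.2 fun e => ?_
    exact (Measurable.of_discrete (f := fun x : Bool => x = true)).comp (measurable_pi_apply e)
  refine ⟨(ν : Measure (E → Bool)).map g, ⟨Measure.isProbabilityMeasure_map hg.aemeasurable, ?_⟩⟩
  intro A
  have hpre : g ⁻¹' {B : Set E | (A : Set E) ⊆ B} = {b | ∀ a ∈ A, b a = true} := by
    ext b; simp [g, Set.subset_def]
  rw [map_measureReal_apply hg (measurableSet_superset A), hpre]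
  have hclopen : IsClopen {b : E → Bool | ∀ a ∈ A, b a = true} := by
    have : {b : E → Bool | ∀ a ∈ A, b a = true} = ⋂ a ∈ A, (fun b => b a) ⁻¹' {true} := by
      ext b; simp
    rw [this]
    exact isClopen_biInter_finset fun a _ => (isClopen_discrete {true}).preimage (continuous_apply a)
  have h1 : Tendsto (fun F => μ F {b : E → Bool | ∀ a ∈ A, b a = true}) 𝓤
      (𝓝 (ν {b : E → Bool | ∀ a ∈ A, b a = true})) :=
    ProbabilityMeasure.tendsto_measure_of_null_frontier_of_tendsto hlim
      (by rw [hclopen.frontier_eq]; simp)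
  have h2 : Tendsto (fun F => (((μ F : Measure (E → Bool)).real
      {b : E → Bool | ∀ a ∈ A, b a = true} : ℝ) : 𝕜)) 𝓤
      (𝓝 (((ν : Measure (E → Bool)).real {b : E → Bool | ∀ a ∈ A, b a = true} : ℝ) : 𝕜)) := by
    have := (NNReal.continuous_coe.tendsto _).comp h1
    exact (RCLike.continuous_ofReal.tendsto _).comp this
  refine tendsto_nhds_unique h2 (tendsto_const_nhds.congr' ?_)
  have h3 : ∀ᶠ F in (𝓤 : Filter (Finset E)), A ⊆ F :=
    (Ultrafilter.of_le atTop) (eventually_ge_atTop A)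
  filter_upwards [h3] with F hF
  exact (hμ F A hF).symm

/-- The `σ`-field `𝓕(E)` is the `σ`-field on which the measures live. -/
theorem sigmaField_univ (E : Type*) :
    sigmaField (Set.univ : Set E) = (inferInstance : MeasurableSpace (Set E)) := by
  refine le_antisymm (MeasurableSpace.generateFrom_le ?_) (iSup_le fun e => ?_)
  · rintro _ ⟨e, -, rfl⟩
    exact measurableSet_mem e
  · rintro _ ⟨S, -, rfl⟩
    have h : MeasurableSet[sigmaField (Set.univ : Set E)] {B : Set E | e ∈ B} :=
      MeasurableSpace.measurableSet_generateFrom ⟨e, trivial, rfl⟩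
    have h' := @measurableSet_setOfPred _ (sigmaField (Set.univ : Set E)) (fun B : Set E => e ∈ B)
    exact (h'.1 h) trivial

/-- The determinantal probability measure `P^H` on the subsets of `E` of a closed subspace `H` of
`ℓ²(E)`: the unique probability measure with `P^H[A ⊆ B] = det (P_H restricted to A)` for all
finite `A ⊆ E`. -/
noncomputable def determinantalMeasure {𝕜 : Type*} [RCLike 𝕜] {E : Type*} [Countable E]
    (H : ClosedSubmodule 𝕜 ℓ²(E, 𝕜)) : Measure (Set E) :=
  (exists_isDeterminantal H).choose

theorem isDeterminantal_determinantalMeasure {𝕜 : Type*} [RCLike 𝕜] {E : Type*} [Countable E]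
    (H : ClosedSubmodule 𝕜 ℓ²(E, 𝕜)) : IsDeterminantal (projMatrix H) (determinantalMeasure H) :=
  (exists_isDeterminantal H).choose_spec

end DeterminantalProbability

open scoped MeasureTheory

/-! Fix a finite `A` and ask how far the configuration on a distant finite set `S` can influence the
event that `A` is contained in the random set. Given a configuration `s` on `S`, the rest is again
determinantal, with a kernel `R s` obtained by successive Schur complements; each `R s` is a
positive contraction, and off `S` the `R s` average to the original kernel `Q`
(`IsConditionalKernel.insert_index`). So `R s` is a random matrix with mean `Q`. A positive
contraction satisfies `∑ f, |R e f|² ≤ R e e`, hence the variance of row `e` over a set `K` disjoint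
from `S` is at most `Q e e - ∑ f ∈ K, |Q e f|²` (`IsConditionalKernel.sum_variance_le`).

This bound does not involve `S`. For a projection `∑ f, |Q e f|² = Q e e` over all of `E`
(`hasSum_norm_sq_projMatrix`), so a large `K` makes it small; continuity of the determinant then
gives small covariance with every cylinder event off `K`. Approximation extends this to all events
off `K`, and a π-λ argument replaces containment of `A` by an arbitrary event. A tail event may be
tested against itself, which gives the zero-one law. -/

namespace DeterminantalProbability

open MeasureTheory Filter Topology
open scoped ENNReal lp ComplexOrder Matrix InnerProductSpace

/-! ### Schur complements, positive contractions and perturbation of minors -/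

section Kernel

variable {𝕜 : Type*} [RCLike 𝕜] {n : Type*} [DecidableEq n]

/-- The Schur complement of a matrix with respect to one index; it vanishes in row and column `g`
if `M g g ≠ 0`. -/
def schurAt (M : Matrix n n 𝕜) (g : n) : Matrix n n 𝕜 :=
  Matrix.of fun i j => M i j - M i g * M g j / M g g

/-- The kernel of a determinantal process with kernel `R` conditioned on `g` not being selected. -/
def kernelWithout (R : Matrix n n 𝕜) (g : n) : Matrix n n 𝕜 := 1 - schurAt (1 - R) g

/-- Positive contractions. -/
structure IsPosContraction (R : Matrix n n 𝕜) : Prop where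
  posSemidef : R.PosSemidef
  posSemidef_one_sub : (1 - R).PosSemidef

/-- An isotropic vector of a positive semidefinite form lies in its kernel; apply this to the basis
vector at `g`. This makes the convention `x / 0 = 0` harmless in the Schur complements. -/
theorem _root_.Matrix.PosSemidef.row_eq_zero [Fintype n] {M : Matrix n n 𝕜} (hM : M.PosSemidef)
    {g : n} (hg : M g g = 0) (j : n) : M g j = 0 := by
  have h : star (Pi.single g (1 : 𝕜)) ⬝ᵥ (M *ᵥ Pi.single g 1) = 0 := by
    simp [hg]
  have h1 := congrFun ((hM.dotProduct_mulVec_zero_iff _).1 h) j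
  simp only [Matrix.mulVec_single_one, Matrix.col_apply, Pi.zero_apply] at h1
  rw [← hM.isHermitian.apply, h1, star_zero]

/-- If `M g g ≠ 0`, column elimination `C` turns `M` into its Schur complement, whose row `g` is
zero, so the matching row operation `Cᴴ` changes nothing further: the complement is the congruence
`Cᴴ * M * C`. -/
theorem posSemidef_schurAt [Fintype n] {M : Matrix n n 𝕜} (hM : M.PosSemidef) (g : n) :
    (schurAt M g).PosSemidef := by
  by_cases h : M g g = 0
  · have : schurAt M g = M := by ext i j; simp [schurAt, h]
    rwa [this]
  let C : Matrix n n 𝕜 := 1 - Matrix.of fun i j => if i = g then M g j / M g g else 0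
  have h1 : M * C = schurAt M g := by
    ext i j
    simp [C, mul_sub, Matrix.mul_apply, Matrix.one_apply, schurAt, mul_div_assoc]
  have h2 : Cᴴ * schurAt M g = schurAt M g := by
    have h3 : ∀ j, schurAt M g g j = 0 := fun j => by simp [schurAt, h]
    ext i j
    simp [C, sub_mul, Matrix.mul_apply, Matrix.one_apply, Matrix.conjTranspose_sub, apply_ite star,
      h3]
  rw [← h2, ← h1, ← mul_assoc]
  exact hM.conjTranspose_mul_mul_same C

/-- The difference is a nonnegative multiple of a rank-one matrix `v v*`. With this, conditioning on
a selected point keeps the kernel below `1`. -/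
theorem posSemidef_sub_schurAt {m : Type*} [Fintype m] {M : Matrix m m 𝕜} (hM : M.PosSemidef)
    (g : m) :
    (M - schurAt M g).PosSemidef := by
  have : M - schurAt M g = (M g g)⁻¹ • Matrix.vecMulVec (fun i => M i g) (star fun i => M i g) := by
    ext i j
    have h : star (M j g) = M g j := hM.isHermitian.apply g j
    rw [Matrix.smul_apply, Matrix.vecMulVec_apply, Pi.star_apply, h]
    simp [schurAt, div_eq_mul_inv, mul_comm]
  rw [this]
  refine (Matrix.posSemidef_vecMulVec_self_star _).smul ?_
  obtain ⟨r, hr, hr'⟩ := RCLike.nonneg_iff_exists_ofReal.1 (hM.diag_nonneg (i := g))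
  rw [← hr', ← RCLike.ofReal_inv]
  exact RCLike.ofReal_nonneg.2 (inv_nonneg.2 hr)

theorem IsPosContraction.schurAt [Fintype n] {R : Matrix n n 𝕜} (hR : IsPosContraction R) (g : n) :
    IsPosContraction (schurAt R g) where
  posSemidef := posSemidef_schurAt hR.1 g
  posSemidef_one_sub := by
    rw [← sub_add_sub_cancel 1 R]
    exact hR.2.add (posSemidef_sub_schurAt hR.1 g)

theorem IsPosContraction.one_sub {R : Matrix n n 𝕜} (hR : IsPosContraction R) :
    IsPosContraction (1 - R) := ⟨hR.2, by simpa using hR.1⟩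

/-- Passing to the complementary process replaces `R` by `1 - R` and exchanges absence with presence
of `g`. -/
theorem IsPosContraction.kernelWithout [Fintype n] {R : Matrix n n 𝕜} (hR : IsPosContraction R)
    (g : n) : IsPosContraction (kernelWithout R g) :=
  (hR.one_sub.schurAt g).one_sub

/-- The identity `R - R² = R(1 - R)R + (1 - R)R(1 - R)` shows `R² ≤ R`; the bound is its diagonal
entry at `e`. -/
theorem IsPosContraction.sum_norm_sq_le [Fintype n] {R : Matrix n n 𝕜} (hR : IsPosContraction R)
    (e : n) : ∑ f, ‖R e f‖ ^ 2 ≤ RCLike.re (R e e) := by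
  have h1 : R * (1 - R) * Rᴴ + (1 - R) * R * (1 - R)ᴴ = R - R * R := by
    rw [hR.1.isHermitian.eq, hR.2.isHermitian.eq]
    noncomm_ring
  have h2 := ((hR.2.mul_mul_conjTranspose_same R).add
    (hR.1.mul_mul_conjTranspose_same (1 - R))).diag_nonneg (i := e)
  rw [h1] at h2
  have h3 : (R * R) e e = ((∑ f, ‖R e f‖ ^ 2 : ℝ) : 𝕜) := by
    rw [Matrix.mul_apply]
    push_cast
    refine Finset.sum_congr rfl fun f _ => ?_
    rw [← hR.1.isHermitian.apply f e, ← RCLike.mul_conj]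
    rfl
  have h4 := (RCLike.nonneg_iff.1 h2).1
  rw [Matrix.sub_apply, h3, map_sub, RCLike.ofReal_re] at h4
  linarith

theorem IsPosContraction.re_apply_self_le_one {R : Matrix n n 𝕜} (hR : IsPosContraction R)
    (e : n) : RCLike.re (R e e) ≤ 1 := by
  have h := (RCLike.nonneg_iff.1 (hR.2.diag_nonneg (i := e))).1
  simpa using h

theorem IsPosContraction.norm_apply_le_one [Fintype n] {R : Matrix n n 𝕜}
    (hR : IsPosContraction R) (e f : n) : ‖R e f‖ ≤ 1 := by
  have h := (Finset.single_le_sum (f := fun f => ‖R e f‖ ^ 2) (fun _ _ => by positivity)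
    (Finset.mem_univ f)).trans ((hR.sum_norm_sq_le e).trans (hR.re_apply_self_le_one e))
  exact (sq_le_one_iff₀ (norm_nonneg _)).1 h

/-- The principal minor of `M` with index set `A`. -/
def minor (M : Matrix n n 𝕜) (A : Finset n) : 𝕜 :=
  (M.submatrix (fun a : A => (a : n)) (fun a : A => (a : n))).det

@[simp] theorem minor_empty (M : Matrix n n 𝕜) : minor M ∅ = 1 := Matrix.det_isEmpty

theorem minor_insert (M : Matrix n n 𝕜) {A : Finset n} {g : n} (hg : g ∉ A) :
    minor M (insert g A) = (Matrix.fromBlocks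
      (M.submatrix (fun a : A => (a : n)) (fun a : A => (a : n)))
      (Matrix.of fun (i : A) (_ : Unit) => M i g) (Matrix.of fun (_ : Unit) (j : A) => M g j)
      (Matrix.of fun (_ _ : Unit) => M g g)).det := by
  let e : (insert g A : Finset n) ≃ A ⊕ Unit :=
    (Finset.subtypeInsertEquivOption hg).trans (Equiv.optionEquivSumPUnit _)
  rw [minor, ← Matrix.det_submatrix_equiv_self e.symm]
  congr 1
  ext (i | i) (j | j) <;> simp [e, Finset.subtypeInsertEquivOption]

/-- The hypothesis on `b` covers a zero pivot: the last row is then zero and both sides vanish. -/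
theorem det_fromBlocks_unit {m : Type*} [Fintype m] [DecidableEq m] (D : Matrix m m 𝕜)
    (c b : m → 𝕜) (r : 𝕜) (h : r = 0 → b = 0) :
    (Matrix.fromBlocks D (Matrix.of fun i (_ : Unit) => c i) (Matrix.of fun (_ : Unit) j => b j)
      (Matrix.of fun (_ _ : Unit) => r)).det
      = r * (Matrix.of fun i j => D i j - c i * b j / r).det := by
  by_cases hr : r = 0
  · rw [hr, zero_mul]
    refine Matrix.det_eq_zero_of_row_eq_zero (Sum.inr ()) ?_
    rintro (j | j) <;> simp [h hr]
  · let _ : Invertible (Matrix.of fun (_ _ : Unit) => r) :=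
      ⟨Matrix.of fun _ _ => r⁻¹, by ext; simp [Matrix.mul_apply, hr],
        by ext; simp [Matrix.mul_apply, hr]⟩
    rw [Matrix.det_fromBlocks₂₂]
    congr 1
    · simp
    · congr 1
      ext i j
      have : (⅟(Matrix.of fun (_ _ : Unit) => r)) = Matrix.of fun _ _ => r⁻¹ := rfl
      simp [Matrix.mul_apply, this]
      ring

theorem minor_insert_eq_schurAt [Fintype n] {R : Matrix n n 𝕜} (hR : R.PosSemidef) {A : Finset n}
    {g : n} (hg : g ∉ A) : minor R (insert g A) = R g g * minor (schurAt R g) A := by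
  rw [minor_insert _ hg, det_fromBlocks_unit _ _ _ _ fun h => funext fun j => hR.row_eq_zero h _]
  rfl

/-- The determinant is linear in row `g`. Row `(0, 1)` gives the smaller minor, and subtracting the
row of `R` leaves pivot `1 - R g g`, about which the Schur complement is taken. Probabilistically,
this factors the event that `A` is selected and `g` is not. -/
theorem minor_sub_minor_insert [Fintype n] {R : Matrix n n 𝕜} (hR : (1 - R).PosSemidef)
    {A : Finset n} {g : n} (hg : g ∉ A) :
    minor R A - minor R (insert g A) = (1 - R g g) * minor (kernelWithout R g) A := by
  let D := R.submatrix (fun a : A => (a : n)) (fun a : A => (a : n))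
  let c : A → 𝕜 := fun i => R i g
  let F : (A → 𝕜) → 𝕜 → Matrix (A ⊕ Unit) (A ⊕ Unit) 𝕜 := fun b r =>
    Matrix.fromBlocks D (Matrix.of fun i (_ : Unit) => c i) (Matrix.of fun (_ : Unit) j => b j)
      (Matrix.of fun (_ _ : Unit) => r)
  have hF : ∀ b r, F b r = (F 0 0).updateRow (Sum.inr ()) (Sum.elim b fun _ => r) := by
    intro b r
    ext (i | i) (j | j) <;> simp [F, Matrix.updateRow_apply]
  have hadd : ∀ b b' r r', (F (b + b') (r + r')).det = (F b r).det + (F b' r').det := by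
    intro b b' r r'
    rw [hF, hF b, hF b', ← Matrix.det_updateRow_add]
    congr 2
    ext (j | j) <;> simp
  have h1 : minor R A = (F 0 1).det := by
    have : (Matrix.of fun (_ _ : Unit) => (1 : 𝕜)) = 1 := by ext; simp
    have h0 : (Matrix.of fun (_ : Unit) (j : A) => (0 : A → 𝕜) j) = 0 := by ext; simp
    simp only [F, this, h0]
    rw [Matrix.det_fromBlocks_zero₂₁, Matrix.det_one, mul_one]
    rfl
  have h2 := hadd (fun j : A => R g j) (-fun j : A => R g j) (R g g) (1 - R g g)
  rw [add_neg_cancel, add_sub_cancel, ← h1] at h2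
  rw [h2, minor_insert _ hg, add_sub_cancel_left]
  simp only [F]
  rw [det_fromBlocks_unit _ _ _ _ fun h => funext fun j => ?_]
  · congr 2
    ext i j
    have hi : (i : n) ≠ g := fun h => hg (h ▸ i.2)
    have hj : g ≠ (j : n) := fun h => hg (h ▸ j.2)
    simp [D, c, kernelWithout, schurAt, hi, hj]
    ring
  · have hj : g ≠ (j : n) := fun h => hg (h ▸ j.2)
    simpa [hj] using hR.row_eq_zero (g := g) (by simpa using h) j

theorem norm_prod_sub_prod_le_sum {ι : Type*} (s : Finset ι) (a b : ι → 𝕜)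
    (ha : ∀ i, ‖a i‖ ≤ 1) (hb : ∀ i, ‖b i‖ ≤ 1) :
    ‖∏ i ∈ s, a i - ∏ i ∈ s, b i‖ ≤ ∑ i ∈ s, ‖a i - b i‖ := by
  classical
  induction s using Finset.induction_on with
  | empty => simp
  | insert i s hi ih =>
    rw [Finset.prod_insert hi, Finset.prod_insert hi, Finset.sum_insert hi,
      show a i * ∏ j ∈ s, a j - b i * ∏ j ∈ s, b j
        = (a i - b i) * ∏ j ∈ s, a j + b i * (∏ j ∈ s, a j - ∏ j ∈ s, b j) by ring]
    have h1 : ‖∏ j ∈ s, a j‖ ≤ 1 := by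
      rw [norm_prod]
      exact Finset.prod_le_one (fun _ _ => norm_nonneg _) fun j _ => ha j
    refine (norm_add_le _ _).trans (add_le_add ?_ ?_)
    · rw [norm_mul]
      exact mul_le_of_le_one_right (norm_nonneg _) h1
    · rw [norm_mul]
      exact (mul_le_of_le_one_left (norm_nonneg _) (hb i)).trans ih

/-- In the Leibniz expansion each permutation contributes a telescoped difference of products, at
most the sum of all entry differences; the factorial counts permutations. -/
theorem norm_det_sub_det_le [Fintype n] (M N : Matrix n n 𝕜) (hM : ∀ i j, ‖M i j‖ ≤ 1)
    (hN : ∀ i j, ‖N i j‖ ≤ 1) :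
    ‖M.det - N.det‖ ≤ (Fintype.card n).factorial * ∑ i, ∑ j, ‖M i j - N i j‖ := by
  rw [Matrix.det_apply', Matrix.det_apply', ← Finset.sum_sub_distrib]
  refine (norm_sum_le_of_le (n := fun _ => ∑ i, ∑ j, ‖M i j - N i j‖) _ fun σ _ => ?_).trans ?_
  · have hs : ‖((Equiv.Perm.sign σ : ℤ) : 𝕜)‖ = 1 := by
      rcases Int.units_eq_one_or (Equiv.Perm.sign σ) with h | h <;> simp [h]
    rw [← mul_sub, norm_mul, hs, one_mul]
    refine (norm_prod_sub_prod_le_sum _ _ _ (fun _ => hM _ _) fun _ => hN _ _).trans ?_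
    rw [Finset.sum_comm]
    refine Finset.sum_le_sum fun i _ => ?_
    exact Finset.single_le_sum (f := fun j => ‖M j i - N j i‖) (fun _ _ => norm_nonneg _)
      (Finset.mem_univ (σ i))
  · simp [Fintype.card_perm]

end Kernel

/-! ### Cylinder events and their decomposition into atoms -/

section Cylinder

variable {E : Type*}

theorem sigmaField_mono {K L : Set E} (h : K ⊆ L) : sigmaField K ≤ sigmaField L :=
  MeasurableSpace.generateFrom_mono fun _ ⟨e, he, hS⟩ => ⟨e, h he, hS⟩

theorem sigmaField_le (K : Set E) : sigmaField K ≤ (inferInstance : MeasurableSpace (Set E)) :=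
  (sigmaField_mono (Set.subset_univ K)).trans_eq (sigmaField_univ E)

/-- The event that the random set agrees with `s` on `S`. -/
def atom (S s : Finset E) : Set (Set E) := {B | ∀ a ∈ S, a ∈ B ↔ a ∈ s}

theorem measurableSet_sigmaField_atom {K : Set E} {S : Finset E} (h : (S : Set E) ⊆ K)
    (s : Finset E) : MeasurableSet[sigmaField K] (atom S s) := by
  have h1 : atom S s = ⋂ a ∈ S, {B : Set E | a ∈ B ↔ a ∈ s} := by
    ext B; simp [atom]
  rw [h1]
  refine @Finset.measurableSet_biInter _ _ (sigmaField K) _ S fun a ha => ?_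
  have h2 : MeasurableSet[sigmaField K] {B : Set E | a ∈ B} :=
    MeasurableSpace.measurableSet_generateFrom ⟨a, h ha, rfl⟩
  by_cases has : a ∈ s
  · simpa [has] using h2
  · simpa [has, Set.compl_ofPred] using h2.compl

theorem measurableSet_atom (S s : Finset E) : MeasurableSet (atom S s) :=
  sigmaField_le _ _ (measurableSet_sigmaField_atom subset_rfl s)

/-- The event `C` depends only on the intersection of the random set with `S`. -/
def IsCylinderOn (S : Finset E) (C : Set (Set E)) : Prop :=
  ∀ ⦃B B' : Set E⦄, (∀ a ∈ S, a ∈ B ↔ a ∈ B') → (B ∈ C ↔ B' ∈ C)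

open Classical in
theorem IsCylinderOn.eq_biUnion_atom {S : Finset E} {C : Set (Set E)} (hC : IsCylinderOn S C) :
    C = ⋃ s ∈ S.powerset.filter (fun s : Finset E => (s : Set E) ∈ C), atom S s := by
  ext B
  simp only [Finset.mem_filter, Finset.mem_powerset, Set.mem_iUnion, exists_prop]
  constructor
  · intro hB
    have h : ∀ a ∈ S, a ∈ B ↔ a ∈ ((S.filter (· ∈ B) : Finset E) : Set E) := by
      intro a ha; simp [ha]
    exact ⟨S.filter (· ∈ B), ⟨Finset.filter_subset _ _, (hC h).1 hB⟩, h⟩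
  · rintro ⟨s, ⟨-, hs⟩, hB⟩
    exact (hC (B' := (s : Set E)) hB).2 hs

theorem IsCylinderOn.measurableSet_sigmaField {K : Set E} {S : Finset E} {C : Set (Set E)}
    (hC : IsCylinderOn S C) (h : (S : Set E) ⊆ K) : MeasurableSet[sigmaField K] C := by
  classical
  rw [hC.eq_biUnion_atom]
  exact @Finset.measurableSet_biUnion _ _ (sigmaField K) _ _ fun s _ =>
    measurableSet_sigmaField_atom h s

theorem pairwiseDisjoint_atom (S : Finset E) :
    Set.PairwiseDisjoint (S.powerset : Set (Finset E)) (atom S) := by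
  intro s hs t ht hst
  refine Set.disjoint_left.2 fun B hB hB' => hst ?_
  ext a
  by_cases ha : a ∈ S
  · exact (hB a ha).symm.trans (hB' a ha)
  · exact iff_of_false (fun h => ha (Finset.mem_powerset.1 hs h))
      fun h => ha (Finset.mem_powerset.1 ht h)

open Classical in
theorem IsCylinderOn.measureReal_inter {S : Finset E} {C : Set (Set E)} (hC : IsCylinderOn S C)
    (μ : Measure (Set E)) [IsFiniteMeasure μ] {X : Set (Set E)} (hX : MeasurableSet X) :
    μ.real (X ∩ C) =
      ∑ s ∈ S.powerset.filter (fun s : Finset E => (s : Set E) ∈ C), μ.real (X ∩ atom S s) := by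
  conv_lhs => rw [hC.eq_biUnion_atom, Set.inter_iUnion₂]
  refine measureReal_biUnion_finset ?_ fun s _ => hX.inter (measurableSet_atom S s)
  refine ((pairwiseDisjoint_atom S).subset ?_).mono fun s => Set.inter_subset_right
  exact_mod_cast Finset.filter_subset _ _

theorem sum_measureReal_atom (S : Finset E) (μ : Measure (Set E)) [IsProbabilityMeasure μ] :
    ∑ s ∈ S.powerset, μ.real (atom S s) = 1 := by
  classical
  have h : IsCylinderOn S (Set.univ : Set (Set E)) := fun _ _ _ => by simp
  have h1 := h.measureReal_inter μ MeasurableSet.univ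
  simpa using h1.symm

end Cylinder

/-! ### Conditional kernels, their variance and the covariance bound -/

section Conditional

variable {𝕜 : Type*} [RCLike 𝕜] {n : Type*} [DecidableEq n]

/-- `R s` is, for each `s ⊆ S`, the kernel of the process with law `μ` conditioned to agree with
`s` on `S`, and these kernels average to `Q` off `S`. -/
structure IsConditionalKernel (μ : Measure (Set n)) (Q : Matrix n n 𝕜) (S : Finset n)
    (R : Finset n → Matrix n n 𝕜) : Prop where
  isPosContraction : ∀ s, IsPosContraction (R s)
  measureReal_inter : ∀ s ⊆ S, ∀ A, Disjoint A S →
    ((μ.real ({B : Set n | (A : Set n) ⊆ B} ∩ atom S s) : ℝ) : 𝕜) =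
      (μ.real (atom S s) : 𝕜) * minor (R s) A
  average : ∀ e ∉ S, ∀ f ∉ S,
    ∑ s ∈ S.powerset, (μ.real (atom S s) : 𝕜) * R s e f = Q e f

variable [Fintype n] {μ : Measure (Set n)} [IsProbabilityMeasure μ] {Q : Matrix n n 𝕜}
  {S : Finset n}

/-- Revealing `g` splits each atom with weights `R g g` and `1 - R g g`. The two new kernels differ
from `R` off `g` by rank-one terms of opposite sign, which cancel after weighting, so the average is
preserved. Working with products rather than quotients of probabilities avoids a separate treatment
of null atoms. -/
theorem IsConditionalKernel.insert_index {R : Finset n → Matrix n n 𝕜}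
    (h : IsConditionalKernel μ Q S R) {g : n} (hg : g ∉ S) :
    IsConditionalKernel μ Q (insert g S)
      (fun t => if g ∈ t then schurAt (R (t.erase g)) g else kernelWithout (R t) g) := by
  have hin : ∀ s : Finset n, ∀ A : Finset n,
      {B : Set n | (A : Set n) ⊆ B} ∩ atom (insert g S) (insert g s) =
        {B : Set n | ((insert g A : Finset n) : Set n) ⊆ B} ∩ atom S s := by
    intro s A
    ext B
    simp only [atom, Set.mem_inter_iff, Set.mem_ofPred_eq, Finset.forall_mem_insert,
      Finset.mem_insert_self, iff_true, Finset.coe_insert, Set.insert_subset_iff]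
    have : (∀ a ∈ S, a ∈ B ↔ a ∈ insert g s) ↔ ∀ a ∈ S, a ∈ B ↔ a ∈ s := by
      refine forall₂_congr fun a ha => ?_
      have : a ≠ g := fun h => hg (h ▸ ha)
      simp [this]
    rw [this]
    tauto
  have hout : ∀ s ⊆ S, ∀ A : Finset n,
      {B : Set n | (A : Set n) ⊆ B} ∩ atom (insert g S) s =
        ({B : Set n | (A : Set n) ⊆ B} ∩ atom S s) \
          ({B : Set n | ((insert g A : Finset n) : Set n) ⊆ B} ∩ atom S s) := by
    intro s hs A
    have hgs : g ∉ s := fun h => hg (hs h)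
    ext B
    simp only [atom, Set.mem_inter_iff, Set.mem_ofPred_eq, Finset.forall_mem_insert, hgs,
      iff_false, Finset.coe_insert, Set.insert_subset_iff, Set.mem_sdiff]
    tauto
  have hin' : ∀ s ⊆ S, ∀ A, Disjoint A (insert g S) →
      ((μ.real ({B : Set n | (A : Set n) ⊆ B} ∩ atom (insert g S) (insert g s)) : ℝ) : 𝕜) =
        (μ.real (atom S s) : 𝕜) * (R s g g * minor (schurAt (R s) g) A) := by
    intro s hs A hA
    rw [Finset.disjoint_insert_right] at hA
    rw [hin, h.measureReal_inter s hs _ (Finset.disjoint_insert_left.2 ⟨hg, hA.2⟩),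
      minor_insert_eq_schurAt (h.isPosContraction s).1 hA.1]
  have hout' : ∀ s ⊆ S, ∀ A, Disjoint A (insert g S) →
      ((μ.real ({B : Set n | (A : Set n) ⊆ B} ∩ atom (insert g S) s) : ℝ) : 𝕜) =
        (μ.real (atom S s) : 𝕜) * ((1 - R s g g) * minor (kernelWithout (R s) g) A) := by
    intro s hs A hA
    rw [Finset.disjoint_insert_right] at hA
    rw [hout s hs, measureReal_sdiff, RCLike.ofReal_sub, h.measureReal_inter s hs _ hA.2,
      h.measureReal_inter s hs _ (Finset.disjoint_insert_left.2 ⟨hg, hA.2⟩), ← mul_sub,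
      minor_sub_minor_insert (h.isPosContraction s).2 hA.1]
    · refine Set.inter_subset_inter_left _ fun B hB => ?_
      exact (Finset.coe_subset.2 (Finset.subset_insert g A)).trans hB
    · exact (measurableSet_superset _).inter (measurableSet_atom S s)
  have hin0 : ∀ s ⊆ S, ((μ.real (atom (insert g S) (insert g s)) : ℝ) : 𝕜) =
      (μ.real (atom S s) : 𝕜) * R s g g := by
    intro s hs
    simpa using hin' s hs ∅ (Finset.disjoint_empty_left _)
  have hout0 : ∀ s ⊆ S, ((μ.real (atom (insert g S) s) : ℝ) : 𝕜) =
      (μ.real (atom S s) : 𝕜) * (1 - R s g g) := by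
    intro s hs
    simpa using hout' s hs ∅ (Finset.disjoint_empty_left _)
  refine ⟨fun t => ?_, fun t ht A hA => ?_, fun e he f hf => ?_⟩
  · split_ifs
    · exact (h.isPosContraction _).schurAt g
    · exact (h.isPosContraction _).kernelWithout g
  · by_cases hgt : g ∈ t
    · have hs : t.erase g ⊆ S := Finset.subset_insert_iff.1 ht
      rw [if_pos hgt]
      conv_lhs => rw [← Finset.insert_erase hgt]
      conv_rhs => rw [← Finset.insert_erase hgt]
      rw [hin' _ hs A hA, hin0 _ hs, Finset.erase_insert (Finset.notMem_erase g t), mul_assoc]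
    · have hs : t ⊆ S := (Finset.subset_insert_iff_of_notMem hgt).1 ht
      rw [if_neg hgt, hout' _ hs A hA, hout0 _ hs, mul_assoc]
  · rw [Finset.mem_insert, not_or] at he hf
    rw [Finset.sum_powerset_insert hg, ← Finset.sum_add_distrib, ← h.average e he.2 f hf.2]
    refine Finset.sum_congr rfl fun s hs => ?_
    rw [Finset.mem_powerset] at hs
    have hgs : g ∉ s := fun h => hg (hs h)
    rw [if_neg hgs, if_pos (Finset.mem_insert_self g s), Finset.erase_insert hgs, hin0 s hs,
      hout0 s hs, mul_assoc, mul_assoc, ← mul_add]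
    congr 1
    -- When a pivot is zero the cancelled product is zero too, because positivity kills the entry `R
    -- s g f`; likewise in `h2` with `1 - R s`.
    have h1 : R s g g * (R s e g * R s g f / R s g g) = R s e g * R s g f := by
      by_cases h0 : R s g g = 0
      · simp [h0, (h.isPosContraction s).1.row_eq_zero h0]
      · field_simp
    have h2 : (1 - R s g g) * (R s e g * R s g f / (1 - R s g g)) = R s e g * R s g f := by
      by_cases h0 : 1 - R s g g = 0
      · have := (h.isPosContraction s).2.row_eq_zero (g := g) (by simpa using h0) f
        simp only [Matrix.sub_apply, Matrix.one_apply_ne (Ne.symm hf.1), zero_sub,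
          neg_eq_zero] at this
        simp [this]
      · field_simp
    simp only [kernelWithout, schurAt, Matrix.of_apply, Matrix.sub_apply, Matrix.one_apply_eq,
      Matrix.one_apply_ne he.1, Matrix.one_apply_ne (Ne.symm hf.1), zero_sub, neg_mul_neg]
    linear_combination h2 - h1

theorem exists_isConditionalKernel (hQ : IsPosContraction Q)
    (hμ : ∀ A : Finset n, ((μ.real {B : Set n | (A : Set n) ⊆ B} : ℝ) : 𝕜) = minor Q A)
    (S : Finset n) : ∃ R, IsConditionalKernel μ Q S R := by
  induction S using Finset.induction_on with
  | empty => exact ⟨fun _ => Q, fun _ => hQ, fun s _ A _ => by simp [atom, hμ],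
      fun e _ f _ => by simp [atom]⟩
  | insert g S hg ih =>
    obtain ⟨R, hR⟩ := ih
    exact ⟨_, hR.insert_index hg⟩

/-- Variance is the mean of the square minus the square of the mean. The mean square of row `e` is
bounded by the mean of `R s e e`, which is `Q e e`. -/
theorem IsConditionalKernel.sum_variance_le {R : Finset n → Matrix n n 𝕜}
    (h : IsConditionalKernel μ Q S R) {K : Finset n} (hK : Disjoint K S) {e : n} (he : e ∈ K) :
    ∑ s ∈ S.powerset, μ.real (atom S s) * ∑ f ∈ K, ‖R s e f - Q e f‖ ^ 2 ≤
      RCLike.re (Q e e) - ∑ f ∈ K, ‖Q e f‖ ^ 2 := by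
  have hKS : ∀ f ∈ K, f ∉ S := fun f hf => Finset.disjoint_left.1 hK hf
  have h1 : ∀ f ∈ K, ∑ s ∈ S.powerset, μ.real (atom S s) * ‖R s e f - Q e f‖ ^ 2 =
      ∑ s ∈ S.powerset, μ.real (atom S s) * ‖R s e f‖ ^ 2 - ‖Q e f‖ ^ 2 := by
    intro f hf
    have h2 : ∀ s, μ.real (atom S s) * ‖R s e f - Q e f‖ ^ 2 = μ.real (atom S s) * ‖R s e f‖ ^ 2
        - 2 * RCLike.re (inner 𝕜 ((μ.real (atom S s) : 𝕜) * R s e f) (Q e f))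
        + μ.real (atom S s) * ‖Q e f‖ ^ 2 := by
      intro s
      rw [@norm_sub_sq 𝕜, ← smul_eq_mul (μ.real (atom S s) : 𝕜), inner_smul_left,
        RCLike.conj_ofReal, RCLike.re_ofReal_mul]
      ring
    simp only [h2]
    rw [Finset.sum_add_distrib, Finset.sum_sub_distrib, ← Finset.mul_sum, ← map_sum, ← sum_inner,
      h.average e (hKS e he) f (hKS f hf), ← Finset.sum_mul, sum_measureReal_atom,
      inner_self_eq_norm_sq]
    ring
  have h2 : ∑ s ∈ S.powerset, μ.real (atom S s) * RCLike.re (R s e e) = RCLike.re (Q e e) := by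
    rw [← h.average e (hKS e he) e (hKS e he), map_sum]
    simp only [RCLike.re_ofReal_mul]
  simp only [Finset.mul_sum]
  rw [Finset.sum_comm, Finset.sum_congr rfl h1, Finset.sum_sub_distrib, Finset.sum_comm, ← h2]
  refine sub_le_sub_right (Finset.sum_le_sum fun s _ => ?_) _
  rw [← Finset.mul_sum]
  refine mul_le_mul_of_nonneg_left ?_ measureReal_nonneg
  exact (Finset.sum_le_univ_sum_of_nonneg fun _ => by positivity).trans
    ((h.isPosContraction s).sum_norm_sq_le e)

/-- The covariance with an atom is its probability times the difference of the minors of `R s` and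
`Q`, so an `L¹` bound on entries suffices, and that follows from the variance. -/
theorem sum_abs_covariance_atom_le (hQ : IsPosContraction Q)
    (hμ : ∀ A : Finset n, ((μ.real {B : Set n | (A : Set n) ⊆ B} : ℝ) : 𝕜) = minor Q A)
    {K A : Finset n} (hK : Disjoint K S) (hA : A ⊆ K) {η : ℝ} (hη : 0 < η)
    (hdef : ∀ e ∈ A, RCLike.re (Q e e) - ∑ f ∈ K, ‖Q e f‖ ^ 2 ≤ η ^ 2) :
    ∑ s ∈ S.powerset, |μ.real ({B : Set n | (A : Set n) ⊆ B} ∩ atom S s) -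
      μ.real {B : Set n | (A : Set n) ⊆ B} * μ.real (atom S s)| ≤
      A.card.factorial * (A.card ^ 2 * η) := by
  obtain ⟨R, hR⟩ := exists_isConditionalKernel hQ hμ S
  have h1 : ∀ s ∈ S.powerset, |μ.real ({B : Set n | (A : Set n) ⊆ B} ∩ atom S s) -
      μ.real {B : Set n | (A : Set n) ⊆ B} * μ.real (atom S s)| ≤
      A.card.factorial * ∑ i : A, ∑ j : A, μ.real (atom S s) * ‖R s i j - Q i j‖ := by
    intro s hs
    rw [← RCLike.norm_ofReal (K := 𝕜), RCLike.ofReal_sub, RCLike.ofReal_mul, hμ,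
      hR.measureReal_inter s (Finset.mem_powerset.1 hs) A (hK.mono_left hA), mul_comm (minor Q A),
      ← mul_sub, norm_mul, RCLike.norm_ofReal, abs_of_nonneg measureReal_nonneg]
    simp only [← Finset.mul_sum]
    rw [mul_left_comm]
    refine mul_le_mul_of_nonneg_left ?_ measureReal_nonneg
    have := norm_det_sub_det_le ((R s).submatrix (fun a : A => (a : n)) (fun a : A => (a : n)))
      (Q.submatrix (fun a : A => (a : n)) (fun a : A => (a : n)))
      (fun i j => (hR.isPosContraction s).norm_apply_le_one i j)
      (fun i j => hQ.norm_apply_le_one i j)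
    simpa [minor] using this
  refine (Finset.sum_le_sum h1).trans ?_
  rw [← Finset.mul_sum, Finset.sum_comm]
  refine mul_le_mul_of_nonneg_left ?_ (by positivity)
  have h2 : ∀ i j : A, ∑ s ∈ S.powerset, μ.real (atom S s) * ‖R s i j - Q i j‖ ≤ η := by
    intro i j
    have h3 : ∑ s ∈ S.powerset, μ.real (atom S s) * ‖R s i j - Q i j‖ ^ 2 ≤ η ^ 2 := by
      refine le_trans (Finset.sum_le_sum fun s _ => ?_)
        ((hR.sum_variance_le hK (hA i.2)).trans (hdef i i.2))
      refine mul_le_mul_of_nonneg_left ?_ measureReal_nonneg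
      exact Finset.single_le_sum (f := fun f => ‖R s i f - Q i f‖ ^ 2) (fun _ _ => by positivity)
        (hA j.2)
    -- The inequality `2ηx ≤ η² + x²` replaces Cauchy–Schwarz; after summation one divides by `2η`.
    have h4 : ∀ s ∈ S.powerset, 2 * η * (μ.real (atom S s) * ‖R s i j - Q i j‖) ≤
        μ.real (atom S s) * η ^ 2 + μ.real (atom S s) * ‖R s i j - Q i j‖ ^ 2 := by
      intro s _
      have h5 := mul_nonneg (measureReal_nonneg (μ := μ) (s := atom S s))
        (sq_nonneg (η - ‖R s i j - Q i j‖))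
      linarith
    have h6 := Finset.sum_le_sum h4
    rw [← Finset.mul_sum, Finset.sum_add_distrib, ← Finset.sum_mul, sum_measureReal_atom] at h6
    have h7 : 2 * η * ∑ s ∈ S.powerset, μ.real (atom S s) * ‖R s i j - Q i j‖ ≤ 2 * η * η := by
      linarith
    exact le_of_mul_le_mul_left h7 (by positivity)
  calc _ = ∑ i : A, ∑ j : A, ∑ s ∈ S.powerset, μ.real (atom S s) * ‖R s i j - Q i j‖ :=
        Finset.sum_congr rfl fun i _ => Finset.sum_comm
    _ ≤ ∑ i : A, ∑ j : A, η := Finset.sum_le_sum fun i _ => Finset.sum_le_sum fun j _ => h2 i j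
    _ = A.card ^ 2 * η := by simp; ring

/-- A cylinder is a union of atoms, and the preceding bound already sums absolute values over all of
them; hence the uniformity in `C`. -/
theorem abs_covariance_cylinder_le (hQ : IsPosContraction Q)
    (hμ : ∀ A : Finset n, ((μ.real {B : Set n | (A : Set n) ⊆ B} : ℝ) : 𝕜) = minor Q A)
    {K A : Finset n} (hK : Disjoint K S) (hA : A ⊆ K) {η : ℝ} (hη : 0 < η)
    (hdef : ∀ e ∈ A, RCLike.re (Q e e) - ∑ f ∈ K, ‖Q e f‖ ^ 2 ≤ η ^ 2)
    {C : Set (Set n)} (hC : IsCylinderOn S C) :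
    |μ.real ({B : Set n | (A : Set n) ⊆ B} ∩ C) -
      μ.real {B : Set n | (A : Set n) ⊆ B} * μ.real C| ≤ A.card.factorial * (A.card ^ 2 * η) := by
  classical
  refine le_trans ?_ (sum_abs_covariance_atom_le hQ hμ hK hA hη hdef)
  have h1 := hC.measureReal_inter μ (measurableSet_superset A)
  have h2 := hC.measureReal_inter μ MeasurableSet.univ
  simp only [Set.univ_inter] at h2
  rw [h1, h2, Finset.mul_sum, ← Finset.sum_sub_distrib]
  refine (Finset.abs_sum_le_sum_abs _ _).trans ?_
  exact Finset.sum_le_sum_of_subset_of_nonneg (Finset.filter_subset _ _) fun _ _ _ => abs_nonneg _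

end Conditional

/-! ### Projection kernels and reduction to finite ground sets -/

section Projection

variable {𝕜 : Type*} [RCLike 𝕜] {E : Type*}

theorem isPosContraction_of_sub_sq {n : Type*} [Fintype n] [DecidableEq n] {Q : Matrix n n 𝕜}
    (hQ : Q.IsHermitian) (hps : (Q - Q * Q).PosSemidef) : IsPosContraction Q where
  posSemidef := by
    have h : Q = (Q - Q * Q) + Qᴴ * Q := by rw [hQ.eq, sub_add_cancel]
    rw [h]
    exact hps.add (Matrix.posSemidef_conjTranspose_mul_self Q)
  posSemidef_one_sub := by
    have h : 1 - Q = (Q - Q * Q) + (1 - Q)ᴴ * (1 - Q) := by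
      rw [Matrix.conjTranspose_sub, Matrix.conjTranspose_one, hQ.eq]
      noncomm_ring
    rw [h]
    exact hps.add (Matrix.posSemidef_conjTranspose_mul_self _)

open Classical in
theorem orthonormal_single : Orthonormal 𝕜 (fun a : E => (lp.single 2 a (1 : 𝕜) : ℓ²(E, 𝕜))) := by
  rw [orthonormal_iff_ite]
  intro i j
  rw [lp.inner_single_left]
  by_cases hij : i = j
  · subst hij; simp
  · simp [hij, lp.single_apply]

theorem isPosContraction_submatrix_projMatrix {n : Type*} [Fintype n] [DecidableEq n]
    (H : ClosedSubmodule 𝕜 ℓ²(E, 𝕜)) {v : n → E} (hv : Function.Injective v) :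
    IsPosContraction ((projMatrix H).submatrix v v) := by
  classical
  obtain ⟨h, h'⟩ := posSemidef_gram_sub_sq H.toSubmodule _ (orthonormal_single.comp v hv)
    ((projMatrix H).submatrix v v) (by ext i j; simp [projMatrix])
  exact isPosContraction_of_sub_sq h h'

/-- The row of `e` is, up to conjugation, the coordinate vector of `P_H δ_e`, and `‖P_H δ_e‖² =
⟨δ_e, P_H δ_e⟩`. For a general positive contraction only an inequality holds; equality makes the
variance bound tend to zero. -/
theorem hasSum_norm_sq_projMatrix (H : ClosedSubmodule 𝕜 ℓ²(E, 𝕜)) (e : E) :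
    HasSum (fun f => ‖projMatrix H e f‖ ^ 2) (RCLike.re (projMatrix H e e)) := by
  classical
  set v : ℓ²(E, 𝕜) := H.toSubmodule.starProjection (lp.single 2 e (1 : 𝕜)) with hv
  have h1 : ∀ f, ‖projMatrix H e f‖ = ‖v f‖ := by
    intro f
    have h : projMatrix H e f = inner 𝕜 v (lp.single 2 f (1 : 𝕜) : ℓ²(E, 𝕜)) := by
      simp only [projMatrix, Matrix.of_apply, hv, Submodule.inner_starProjection_left_eq_right]
    rw [h, ← inner_conj_symm, RCLike.norm_conj, lp.inner_single_left]
    simp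
  have h2 : RCLike.re (projMatrix H e e) = ‖v‖ ^ 2 := by
    have h : projMatrix H e e = inner 𝕜 v v := by
      have h3 : H.toSubmodule.starProjection v = v :=
        Submodule.starProjection_eq_self_iff.2 (Submodule.starProjection_apply_mem _ _)
      conv_rhs => enter [2]; rw [hv]
      rw [← Submodule.inner_starProjection_left_eq_right, h3, hv,
        Submodule.inner_starProjection_left_eq_right]
      simp only [projMatrix, Matrix.of_apply]
    rw [h, inner_self_eq_norm_sq]
  have h3 := lp.hasSum_norm (p := 2) (by simp) v
  simp only [h1, h2]
  simpa using h3

theorem minor_submatrix_projMatrix {n : Type*} [Fintype n] [DecidableEq n]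
    {H : ClosedSubmodule 𝕜 ℓ²(E, 𝕜)} {μ : Measure (Set E)} (hμ : IsDeterminantal (projMatrix H) μ)
    (v : n ↪ E) (A : Finset n) :
    ((μ.real {B : Set E | ((A.map v : Finset E) : Set E) ⊆ B} : ℝ) : 𝕜) =
      minor ((projMatrix H).submatrix v v) A := by
  classical
  let e : A ≃ (A.map v : Finset E) := Equiv.ofBijective
    (fun a => ⟨v a, Finset.mem_map_of_mem v a.2⟩)
    ⟨fun a b h => Subtype.ext (v.injective (congrArg Subtype.val h)), fun ⟨b, hb⟩ => by
      obtain ⟨a, ha, rfl⟩ := Finset.mem_map.1 hb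
      exact ⟨⟨a, ha⟩, rfl⟩⟩
  rw [hμ.prob_subset, ← Matrix.det_submatrix_equiv_self e, minor]
  congr!

/-- `K` is fixed from `A` and `ε` alone; only then is the process restricted to the finite set `K ∪
S`, where the compressed kernel is still a positive contraction though no longer necessarily a
projection. -/
theorem IsDeterminantal.exists_abs_covariance_cylinder_le {H : ClosedSubmodule 𝕜 ℓ²(E, 𝕜)}
    {μ : Measure (Set E)} (hμ : IsDeterminantal (projMatrix H) μ) (A : Finset E) {ε : ℝ}
    (hε : 0 < ε) : ∃ K : Finset E, ∀ S : Finset E, Disjoint K S → ∀ C, IsCylinderOn S C →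
      |μ.real ({B : Set E | (A : Set E) ⊆ B} ∩ C) -
        μ.real {B : Set E | (A : Set E) ⊆ B} * μ.real C| ≤ ε := by
  classical
  have := hμ.isProbabilityMeasure
  obtain ⟨η, hη, hηε⟩ : ∃ η : ℝ, 0 < η ∧ A.card.factorial * (A.card ^ 2 * η) ≤ ε := by
    -- The `+ 1` keeps the denominator positive when `A` is empty.
    refine ⟨ε / (A.card.factorial * A.card ^ 2 + 1), by positivity, ?_⟩
    rw [← mul_assoc, mul_div_assoc', div_le_iff₀ (by positivity)]
    nlinarith
  have h1 : ∀ᶠ K : Finset E in atTop, ∀ e ∈ A,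
      RCLike.re (projMatrix H e e) - ∑ f ∈ K, ‖projMatrix H e f‖ ^ 2 ≤ η ^ 2 := by
    rw [Filter.eventually_all_finset]
    intro e _
    have h2 := (tendsto_const_nhds (x := RCLike.re (projMatrix H e e))).sub
      (hasSum_norm_sq_projMatrix H e)
    rw [sub_self] at h2
    exact h2.eventually_le_const (by positivity)
  obtain ⟨K, hK, hAK⟩ := (h1.and (eventually_ge_atTop A)).exists
  refine ⟨K, fun S hKS C hC => le_trans ?_ hηε⟩
  let v : (K ∪ S : Finset E) ↪ E := Function.Embedding.subtype _
  let π : Set E → Set (K ∪ S : Finset E) := fun B => v ⁻¹' B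
  have hπ : Measurable π := measurable_set_iff.2 fun a => measurable_set_mem (v a)
  let Q := (projMatrix H).submatrix v v
  have hsub : ∀ {T : Finset E}, T ⊆ K ∪ S → (T.subtype (· ∈ K ∪ S)).map v = T := fun hT =>
    Finset.subtype_map_of_mem fun x hx => hT hx
  have hpre : ∀ T : Finset (K ∪ S : Finset E),
      π ⁻¹' {B | (T : Set (K ∪ S : Finset E)) ⊆ B} =
        {B : Set E | ((T.map v : Finset E) : Set E) ⊆ B} := by
    intro T
    ext B
    simp only [π, Set.mem_preimage, Set.mem_ofPred_eq, Finset.coe_map, Set.image_subset_iff]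
  have := Measure.isProbabilityMeasure_map (μ := μ) hπ.aemeasurable
  have hmem : ∀ {a : E} (ha : a ∈ K ∪ S) (B : Set (K ∪ S : Finset E)),
      a ∈ v '' B ↔ ⟨a, ha⟩ ∈ B := fun ha B => v.injective.mem_set_image (a := ⟨_, ha⟩)
  -- Since `C` only looks at `S`, it is recovered as the preimage of `C'` under restriction.
  let C' : Set (Set (K ∪ S : Finset E)) := {B | v '' B ∈ C}
  have hC' : IsCylinderOn (S.subtype (· ∈ K ∪ S)) C' := by
    intro B B' hBB'
    refine hC fun a ha => ?_
    have ha' : a ∈ K ∪ S := Finset.mem_union_right _ ha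
    rw [hmem ha', hmem ha']
    exact hBB' ⟨a, ha'⟩ (Finset.mem_subtype.2 ha)
  have hCpre : π ⁻¹' C' = C := by
    ext B
    refine hC fun a ha => ?_
    exact hmem (Finset.mem_union_right _ ha) (π B)
  have hCm : MeasurableSet C' :=
    sigmaField_le _ _ (hC'.measurableSet_sigmaField subset_rfl)
  have key := abs_covariance_cylinder_le (μ := μ.map π) (Q := Q) (S := S.subtype (· ∈ K ∪ S))
    (K := K.subtype (· ∈ K ∪ S)) (A := A.subtype (· ∈ K ∪ S)) (C := C') (η := η)
    (isPosContraction_submatrix_projMatrix H v.injective)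
    (fun T => by
      rw [map_measureReal_apply hπ (measurableSet_superset T), hpre,
        minor_submatrix_projMatrix hμ])
    (by
      rw [Finset.disjoint_left] at hKS ⊢
      intro a ha ha'
      exact hKS (Finset.mem_subtype.1 ha) (Finset.mem_subtype.1 ha'))
    (fun a ha => Finset.mem_subtype.2 (hAK (Finset.mem_subtype.1 ha))) hη
    (fun e he => by
      refine le_of_eq_of_le ?_ (hK e (Finset.mem_subtype.1 he))
      congr 1
      exact Finset.sum_subtype_of_mem (fun f => ‖projMatrix H e f‖ ^ 2)
        fun x hx => Finset.mem_union_left _ hx) hC'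
  rw [map_measureReal_apply hπ (measurableSet_superset _),
    map_measureReal_apply hπ ((measurableSet_superset _).inter hCm),
    map_measureReal_apply hπ hCm, Set.preimage_inter, hCpre, hpre,
    hsub (hAK.trans Finset.subset_union_left), ← Finset.card_map v,
    hsub (hAK.trans Finset.subset_union_left)] at key
  exact key

end Projection

/-! ### From cylinder events to all events, and the zero-one law -/

section Mixing

variable {E : Type*}

/-- The covariance of the indicators of two events. -/
def eventCov {Ω : Type*} [MeasurableSpace Ω] (μ : Measure Ω) (A B : Set Ω) : ℝ :=
  μ.real (A ∩ B) - μ.real A * μ.real B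

section

variable {Ω : Type*} [MeasurableSpace Ω] {μ : Measure Ω}

theorem eventCov_comm (A B : Set Ω) : eventCov μ A B = eventCov μ B A := by
  rw [eventCov, eventCov, Set.inter_comm, mul_comm]

variable [IsProbabilityMeasure μ]

/-- The intersection term and the product term each change by at most the measure of the symmetric
difference. The bound is independent of `C`, so approximation preserves uniformity. -/
theorem abs_eventCov_sub_le {A B C : Set Ω} (hA : MeasurableSet A) (hB : MeasurableSet B)
    (hC : MeasurableSet C) :
    |eventCov μ A C - eventCov μ B C| ≤ 2 * μ.real (symmDiff A B) := by
  have h1 : |μ.real (A ∩ C) - μ.real (B ∩ C)| ≤ μ.real (symmDiff A B) := by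
    refine (abs_measureReal_sub_le_measureReal_symmDiff (hA.inter hC).nullMeasurableSet
      (hB.inter hC).nullMeasurableSet).trans (measureReal_mono ?_)
    rintro x (⟨h, h'⟩ | ⟨h, h'⟩)
    · exact Or.inl ⟨h.1, fun hx => h' ⟨hx, h.2⟩⟩
    · exact Or.inr ⟨h.1, fun hx => h' ⟨hx, h.2⟩⟩
  have h2 : |(μ.real A - μ.real B) * μ.real C| ≤ μ.real (symmDiff A B) := by
    rw [abs_mul, abs_of_nonneg (measureReal_nonneg (μ := μ) (s := C))]
    exact (mul_le_of_le_one_right (abs_nonneg _) measureReal_le_one).trans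
      (abs_measureReal_sub_le_measureReal_symmDiff hA.nullMeasurableSet hB.nullMeasurableSet)
  have h3 : eventCov μ A C - eventCov μ B C =
      (μ.real (A ∩ C) - μ.real (B ∩ C)) - (μ.real A - μ.real B) * μ.real C := by
    simp only [eventCov]; ring
  rw [h3]
  exact (abs_sub _ _).trans (by linarith)

theorem eventCov_compl {A B : Set Ω} (hA : MeasurableSet A) :
    eventCov μ Aᶜ B = -eventCov μ A B := by
  have h1 := measureReal_inter_add_sdiff (μ := μ) (s := B) hA
  have h2 := probReal_compl_eq_one_sub (μ := μ) hA
  rw [eventCov, eventCov, h2, Set.inter_comm, Set.inter_comm A, ← Set.sdiff_eq]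
  linarith

theorem eventCov_union {A A' B : Set Ω} (hA' : MeasurableSet A') (hB : MeasurableSet B)
    (h : Disjoint A A') : eventCov μ (A ∪ A') B = eventCov μ A B + eventCov μ A' B := by
  rw [eventCov, eventCov, eventCov, Set.union_inter_distrib_right, measureReal_union h hA',
    measureReal_union (h.mono Set.inter_subset_left Set.inter_subset_left) (hA'.inter hB)]
  ring

end

/-- The event `A` is asymptotically independent of the events far away. -/
def IsMixing (μ : Measure (Set E)) (A : Set (Set E)) : Prop :=
  ∀ ε : ℝ, 0 < ε → ∃ K : Finset E,
    ∀ C : Set (Set E), MeasurableSet[sigmaField (K : Set E)ᶜ] C → |eventCov μ A C| ≤ ε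

/-- The algebra generates only the smaller σ-field `m`, so density is applied to the trimmed
measure. -/
theorem exists_mem_symmDiff_lt_of_isSetAlgebra {X : Type*} {m m0 : MeasurableSpace X}
    (hle : m ≤ m0) (μ : Measure[m0] X) [IsFiniteMeasure μ] {𝒜 : Set (Set X)}
    (halg : IsSetAlgebra 𝒜) (hgen : m = MeasurableSpace.generateFrom 𝒜) {C : Set X}
    (hC : MeasurableSet[m] C) {ε : ℝ} (hε : 0 < ε) : ∃ D ∈ 𝒜, μ.real (symmDiff C D) < ε := by
  have hfin : @IsFiniteMeasure _ m (μ.trim hle) := isFiniteMeasure_trim hle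
  obtain ⟨D, hD, hlt⟩ := @Measure.MeasureDense.approx X m (μ.trim hle) 𝒜
    (@Measure.MeasureDense.of_generateFrom_isSetAlgebra_finite X m (μ.trim hle) 𝒜 hfin halg hgen)
    C hC (@measure_ne_top X m (μ.trim hle) hfin C) ε hε
  have hDm : MeasurableSet[m] D := hgen ▸ MeasurableSpace.measurableSet_generateFrom hD
  rw [trim_measurableSet_eq hle (@MeasurableSet.symmDiff X m C D hC hDm)] at hlt
  exact ⟨D, hD, (ENNReal.lt_ofReal_iff_toReal_lt (measure_ne_top _ _)).1 hlt⟩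

theorem exists_isCylinderOn_symmDiff_lt (μ : Measure (Set E)) [IsProbabilityMeasure μ]
    (K : Set E) {C : Set (Set E)} (hC : MeasurableSet[sigmaField K] C) {ε : ℝ} (hε : 0 < ε) :
    ∃ S : Finset E, (S : Set E) ⊆ K ∧ ∃ D, IsCylinderOn S D ∧ μ.real (symmDiff C D) < ε := by
  classical
  let 𝒜 : Set (Set (Set E)) := {D | ∃ S : Finset E, (S : Set E) ⊆ K ∧ IsCylinderOn S D}
  have hmem : ∀ D ∈ 𝒜, MeasurableSet[sigmaField K] D := fun D ⟨S, hS, hD⟩ =>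
    hD.measurableSet_sigmaField hS
  have hgen : sigmaField K = MeasurableSpace.generateFrom 𝒜 := by
    refine le_antisymm (MeasurableSpace.generateFrom_mono ?_)
      (MeasurableSpace.generateFrom_le hmem)
    rintro _ ⟨e, he, rfl⟩
    exact ⟨{e}, by simpa using he, fun B B' h => h e (Finset.mem_singleton_self e)⟩
  have halg : IsSetAlgebra 𝒜 := by
    refine ⟨⟨∅, by simp, fun B B' _ => Iff.rfl⟩, ?_, ?_⟩
    · rintro D ⟨S, hS, hD⟩
      exact ⟨S, hS, fun B B' h => not_congr (hD h)⟩
    · rintro D D' ⟨S, hS, hD⟩ ⟨S', hS', hD'⟩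
      refine ⟨S ∪ S', by simp [hS, hS'], fun B B' h => or_congr (hD fun a ha => ?_)
        (hD' fun a ha => ?_)⟩
      · exact h a (Finset.mem_union_left _ ha)
      · exact h a (Finset.mem_union_right _ ha)
  obtain ⟨D, ⟨S, hS, hD⟩, hlt⟩ :=
    exists_mem_symmDiff_lt_of_isSetAlgebra (sigmaField_le K) μ halg hgen hC hε
  exact ⟨S, hS, D, hD, hlt⟩

/-- Because `c` does not depend on `S`, the bound survives approximation by cylinders. -/
theorem abs_eventCov_le_of_isCylinderOn {μ : Measure (Set E)} [IsProbabilityMeasure μ]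
    {A : Set (Set E)} (hA : MeasurableSet A) {K : Finset E} {c : ℝ}
    (h : ∀ S : Finset E, Disjoint K S → ∀ C, IsCylinderOn S C → |eventCov μ A C| ≤ c)
    {C : Set (Set E)} (hC : MeasurableSet[sigmaField (K : Set E)ᶜ] C) : |eventCov μ A C| ≤ c := by
  refine le_of_forall_pos_le_add fun δ hδ => ?_
  obtain ⟨S, hS, D, hD, hlt⟩ := exists_isCylinderOn_symmDiff_lt μ _ hC (half_pos hδ)
  have h1 := h S (Finset.disjoint_left.2 fun a ha ha' => hS ha' ha) D hD
  have h2 := abs_eventCov_sub_le (μ := μ) (sigmaField_le _ _ hC)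
    (sigmaField_le _ _ (hD.measurableSet_sigmaField subset_rfl)) hA
  rw [eventCov_comm C, eventCov_comm D] at h2
  have h3 := abs_sub_abs_le_abs_sub (eventCov μ A C) (eventCov μ A D)
  linarith

theorem generateFrom_superset (E : Type*) : (inferInstance : MeasurableSpace (Set E)) =
    MeasurableSpace.generateFrom (Set.range fun A : Finset E => {B : Set E | (A : Set E) ⊆ B}) := by
  refine le_antisymm ((sigmaField_univ E).symm.trans_le ?_) (MeasurableSpace.generateFrom_le ?_)
  · refine MeasurableSpace.generateFrom_mono ?_
    rintro _ ⟨e, -, rfl⟩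
    exact ⟨{e}, by simp⟩
  · rintro _ ⟨A, rfl⟩
    exact measurableSet_superset A

variable {μ : Measure (Set E)}

theorem isMixing_empty : IsMixing μ ∅ := fun ε hε =>
  ⟨∅, fun C _ => by simpa [eventCov] using hε.le⟩

variable [IsProbabilityMeasure μ]

theorem IsMixing.compl {A : Set (Set E)} (hA : MeasurableSet A) (h : IsMixing μ A) :
    IsMixing μ Aᶜ := by
  intro ε hε
  obtain ⟨K, hK⟩ := h ε hε
  exact ⟨K, fun C hC => by rw [eventCov_compl hA, abs_neg]; exact hK C hC⟩

theorem IsMixing.union {A A' : Set (Set E)} (hA' : MeasurableSet A') (hd : Disjoint A A')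
    (h : IsMixing μ A) (h' : IsMixing μ A') : IsMixing μ (A ∪ A') := by
  classical
  intro ε hε
  obtain ⟨K, hK⟩ := h (ε / 2) (half_pos hε)
  obtain ⟨K', hK'⟩ := h' (ε / 2) (half_pos hε)
  refine ⟨K ∪ K', fun C hC => ?_⟩
  rw [eventCov_union hA' (sigmaField_le _ _ hC) hd]
  have h1 := hK C (sigmaField_mono (by simp) _ hC)
  have h2 := hK' C (sigmaField_mono (by simp) _ hC)
  exact (abs_add_le _ _).trans (by linarith)

theorem IsMixing.iUnion {A : ℕ → Set (Set E)} (hA : ∀ i, MeasurableSet (A i))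
    (hd : Pairwise (Function.onFun Disjoint A)) (h : ∀ i, IsMixing μ (A i)) :
    IsMixing μ (⋃ i, A i) := by
  have hfin : ∀ N, IsMixing μ (⋃ i ∈ Finset.range N, A i) := by
    intro N
    induction N with
    | zero => simpa using isMixing_empty
    | succ N ih =>
      rw [Finset.range_add_one, Finset.set_biUnion_insert, Set.union_comm]
      refine ih.union (hA N) (Set.disjoint_iUnion₂_left.2 fun i hi => hd ?_) (h N)
      exact (Finset.mem_range.1 hi).ne
  have hm : ∀ N, MeasurableSet (⋃ i ∈ Finset.range N, A i) := fun N =>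
    Finset.measurableSet_biUnion _ fun i _ => hA i
  have hlim : Tendsto (fun N => μ.real (⋃ i ∈ Finset.range N, A i)) atTop
      (𝓝 (μ.real (⋃ i, A i))) := by
    have h1 : ⋃ N, ⋃ i ∈ Finset.range N, A i = ⋃ i, A i := by
      refine subset_antisymm (Set.iUnion_subset fun N => Set.iUnion₂_subset fun i _ =>
        Set.subset_iUnion A i) (Set.iUnion_subset fun i => ?_)
      exact (Set.subset_biUnion_of_mem (u := A) (Finset.self_mem_range_succ i)).trans
        (Set.subset_iUnion (fun N => ⋃ i ∈ Finset.range N, A i) (i + 1))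
    rw [← h1]
    refine (ENNReal.tendsto_toReal (measure_ne_top _ _)).comp (tendsto_measure_iUnion_atTop ?_)
    exact fun N M hNM => Set.biUnion_subset_biUnion_left (Finset.range_mono hNM)
  intro ε hε
  -- A remainder below `ε / 4` costs at most `ε / 2` in covariance, by the factor 2 in
  -- `abs_eventCov_sub_le`.
  obtain ⟨N, hN⟩ := (hlim.eventually (lt_mem_nhds (sub_lt_self (μ.real (⋃ i, A i))
    (by positivity : 0 < ε / 4)))).exists
  obtain ⟨K, hK⟩ := hfin N (ε / 2) (half_pos hε)
  refine ⟨K, fun C hC => ?_⟩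
  have hsub : (⋃ i ∈ Finset.range N, A i) ⊆ ⋃ i, A i :=
    Set.iUnion₂_subset fun i _ => Set.subset_iUnion A i
  have h1 := abs_eventCov_sub_le (μ := μ) (MeasurableSet.iUnion hA) (hm N) (sigmaField_le _ _ hC)
  have h2 : symmDiff (⋃ i, A i) (⋃ i ∈ Finset.range N, A i) =
      (⋃ i, A i) \ ⋃ i ∈ Finset.range N, A i := symmDiff_of_ge hsub
  rw [h2, measureReal_sdiff hsub (hm N)] at h1
  have h3 := abs_sub_abs_le_abs_sub (eventCov μ (⋃ i, A i) C)
    (eventCov μ (⋃ i ∈ Finset.range N, A i) C)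
  have h4 := hK C hC
  linarith

/-- Mixing events are closed under complements and countable disjoint unions, and the containment
events form a generating π-system. -/
theorem IsDeterminantal.isMixing {𝕜 : Type*} [RCLike 𝕜] {H : ClosedSubmodule 𝕜 ℓ²(E, 𝕜)}
    {μ : Measure (Set E)} (hμ : IsDeterminantal (projMatrix H) μ) {A : Set (Set E)}
    (hA : MeasurableSet A) : IsMixing μ A := by
  classical
  have := hμ.isProbabilityMeasure
  induction A, hA using MeasurableSpace.induction_on_inter (generateFrom_superset E) with
  | h_inter =>
    rintro _ ⟨A, rfl⟩ _ ⟨A', rfl⟩ -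
    exact ⟨A ∪ A', by ext B; simp⟩
  | empty => exact isMixing_empty
  | basic A hA =>
    obtain ⟨A, rfl⟩ := hA
    intro ε hε
    obtain ⟨K, hK⟩ := hμ.exists_abs_covariance_cylinder_le A hε
    exact ⟨K, fun C hC => abs_eventCov_le_of_isCylinderOn (measurableSet_superset A) hK hC⟩
  | compl A hA h => exact h.compl hA
  | iUnion A hd hA h => exact IsMixing.iUnion hA hd h

/-- A tail event is measurable off every finite `K`, so it may serve as its own distant event,
giving `μ(A) = μ(A)²`. -/
theorem hasTrivialTail_of_isMixing (h : ∀ A, MeasurableSet A → IsMixing μ A) :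
    HasTrivialTail μ := by
  intro A hA
  have hK : ∀ K : Finset E, MeasurableSet[sigmaField (K : Set E)ᶜ] A := fun K =>
    iInf_le (fun K : Finset E => sigmaField (K : Set E)ᶜ) K A hA
  have h1 : eventCov μ A A = 0 := by
    refine abs_nonpos_iff.1 (le_of_forall_pos_le_add fun ε hε => ?_)
    obtain ⟨K, hK'⟩ := h A (sigmaField_le _ _ (hK ∅)) ε hε
    simpa using hK' A (hK K)
  have h2 : μ.real A * (1 - μ.real A) = 0 := by
    rw [eventCov, Set.inter_self] at h1
    linarith
  rcases mul_eq_zero.1 h2 with h3 | h3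
  · exact Or.inl ((measureReal_eq_zero_iff).1 h3)
  · exact Or.inr ((ENNReal.toReal_eq_one_iff _).1 (sub_eq_zero.1 h3).symm)

end Mixing

end DeterminantalProbability

theorem mainTheorem6 {𝕜 : Type*} [RCLike 𝕜] {E : Type*} [Countable E]
    (H : ClosedSubmodule 𝕜 (lp (fun _ : E => 𝕜) 2)) :
    DeterminantalProbability.HasTrivialTail (DeterminantalProbability.determinantalMeasure H) ∧
    ∀ A₁ : Set (Set E), MeasurableSet[DeterminantalProbability.sigmaField Set.univ] A₁ →
      ∀ ε : ℝ, 0 < ε → ∃ K : Finset E,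
        ∀ A₂ : Set (Set E), MeasurableSet[DeterminantalProbability.sigmaField (K : Set E)ᶜ] A₂ →
          |(DeterminantalProbability.determinantalMeasure H).real (A₁ ∩ A₂) -
            (DeterminantalProbability.determinantalMeasure H).real A₁ *
              (DeterminantalProbability.determinantalMeasure H).real A₂| < ε := by
  have hμ := DeterminantalProbability.isDeterminantal_determinantalMeasure H
  have := hμ.isProbabilityMeasure
  refine ⟨DeterminantalProbability.hasTrivialTail_of_isMixing fun A hA => hμ.isMixing hA,
    fun A₁ hA₁ ε hε => ?_⟩
  -- Halving turns the weak inequality in `IsMixing` into a strict one.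
  obtain ⟨K, hK⟩ := hμ.isMixing (DeterminantalProbability.sigmaField_le _ _ hA₁) (ε / 2)
    (half_pos hε)
  exact ⟨K, fun A₂ hA₂ => (hK A₂ hA₂).trans_lt (half_lt_self hε)⟩
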